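/- Let $n,k,p\ge 1$ be integers. Let $X\in\mathcal M_n(\mathbb C)$ and $Y\in\mathcal M_k(\mathbb C)$ be fixed rank-one orthogonal projectors, let $U$ be a random unitary matrix distributed according to the Haar probability measure on the unitary group $\mathcal U(nk)$ of $\mathbb C^n\otimes\mathbb C^k$, and let $$Z=\operatorname{Tr}_k\left[U(X\otimes Y)U^*\right]\in\mathcal M_n(\mathbb C)$$ be the output of the corresponding random quantum channel, where $\operatorname{Tr}_k$ is the partial trace over $\mathbb C^k$. Then $\operatorname{Tr}(Z^p)$ is integrable and $$\mathbb E\left[\operatorname{Tr}(Z^p)\right]=\left(\prod_{j=0}^{p-1}(nk+j)\right)^{-1}\sum_{\alpha\in S_p}k^{\#\alpha}\,n^{\#(\gamma^{-1}\alpha)},$$ where $S_p$ is the group of permutations of $\{1,\dots,p\}$, $\#\sigma$ is the number of cycles of $\sigma$ (fixed points included), and $\gamma=(p\;\,p-1\;\cdots\;2\;1)\in S_p$ is the full cycle. -/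

import Mathlib

open MeasureTheory
open scoped Kronecker Matrix

namespace RandomChannel

/-- A rank-one (orthogonal) projector: `P * P = P`, `Pᴴ = P`, `rank P = 1`. -/
def IsRankOneProjector {m : Type*} [Fintype m] (P : Matrix m m ℂ) : Prop :=
  IsStarProjection P ∧ P.rank = 1

/-- The partial trace `Tr_k : M_n(ℂ) ⊗ M_k(ℂ) → M_n(ℂ)` over the second tensor factor. -/
def partialTrace {m e : Type*} [Fintype e] (A : Matrix (m × e) (m × e) ℂ) : Matrix m m ℂ :=
  Matrix.of fun i j => ∑ a, A (i, a) (j, a)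

/-- The quantum channel `X ↦ Tr_k [U (X ⊗ Y) U*]`, where `U` is a unitary matrix acting on
`ℂⁿ ⊗ ℂᵏ`. -/
def channel {n k : ℕ} (U : Matrix.unitaryGroup (Fin n × Fin k) ℂ)
    (Y : Matrix (Fin k) (Fin k) ℂ) (X : Matrix (Fin n) (Fin n) ℂ) : Matrix (Fin n) (Fin n) ℂ :=
  partialTrace (U.1 * (X ⊗ₖ Y) * U.1ᴴ)

/-- The number of cycles of a permutation; fixed points count as cycles. -/
noncomputable def numCycles {ι : Type*} (α : Equiv.Perm ι) : ℕ :=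
  Nat.card (Quotient (Equiv.Perm.SameCycle.setoid α))

/-- The full cycle `γ = (p p-1 ⋯ 2 1)`, i.e. `i ↦ i - 1` cyclically. -/
def fullCycle (p : ℕ) : Equiv.Perm (Fin p) := (finRotate p)⁻¹

end RandomChannel

/-! Writing `X = xx*`, `Y = yy*`, the channel output is the partial trace of the projector onto `U
v`, where `v = x ⊗ y` is a unit vector. So `Tr (Z ^ p)` is a sum of degree `(p, p)` monomials in the
coordinates of `U v` and their conjugates, and only the law of `U v` matters.

Its mixed moments (`moment_eq`) are found without Weingarten calculus. Left invariance makes `E |⟨x,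
U v⟩| ^ (2p)` equal to `C ‖x‖ ^ (2p)`. The form `∑ α, [f = g ∘ α]` also produces a multiple of `‖x‖
^ (2p)`, and `eq_zero_of_forall_sum_eq_zero` recovers coefficients from values, so the two are
proportional. The identity `‖U v‖ = 1` fixes the constant.

What remains is a count: for each `α`, the pairs of index maps surviving in the trace are those
constant on the cycles of `γ⁻¹ α` and of `α` respectively. -/

namespace RandomChannel

/-- The number of maps `ι → κ` that are constant on the cycles of `σ`. -/
theorem card_comp_eq_self {ι κ : Type*} [Fintype ι] [DecidableEq ι] [Fintype κ] [DecidableEq κ]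
    (σ : Equiv.Perm ι) :
    Fintype.card {a : ι → κ // a ∘ σ = a} = Fintype.card κ ^ numCycles σ := by
  classical
  have key (a : ι → κ) (ha : a ∘ σ = a) (i j : ι) (h : σ.SameCycle i j) : a i = a j := by
    obtain ⟨m, rfl⟩ := h
    have hz (m : ℤ) : ∀ i, a ((σ ^ m) i) = a i := by
      induction m with
      | zero => simp
      | succ m ih =>
        intro i
        rw [zpow_add, zpow_one, Equiv.Perm.mul_apply, ih]
        exact congrFun ha i
      | pred m ih =>
        intro i
        rw [zpow_sub, zpow_one, Equiv.Perm.mul_apply, ih]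
        simpa using (congrFun ha (σ⁻¹ i)).symm
    exact (hz m i).symm
  let e : {a : ι → κ // a ∘ σ = a} ≃ (Quotient (Equiv.Perm.SameCycle.setoid σ) → κ) :=
    { toFun := fun a => Quotient.lift a.1 (fun i j h => key a.1 a.2 i j h)
      invFun := fun b => ⟨fun i => b (Quotient.mk _ i), by
        funext i
        refine congrArg b (Quotient.sound ?_)
        exact Equiv.Perm.sameCycle_apply_left.2 (Equiv.Perm.SameCycle.refl σ i)⟩
      left_inv := fun a => rfl
      right_inv := fun b => by
        funext q
        induction q using Quotient.inductionOn
        rfl }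
  rw [Fintype.card_congr e, Fintype.card_fun, numCycles, Nat.card_eq_fintype_card]

/-! ### Permutations carrying one word to another -/

section Rearrangements

theorem multiset_comp_perm {ι : Type*} {p : ℕ} (g : Fin p → ι) (α : Equiv.Perm (Fin p)) :
    Finset.univ.val.map (g ∘ α) = Finset.univ.val.map g := by
  rw [← Multiset.map_map]
  simp

variable {ι : Type*} [DecidableEq ι] {p : ℕ}

/-- The number of permutations that carry `g` to `f`. -/
def numRearrangements (f g : Fin p → ι) : ℕ :=
  Fintype.card {α : Equiv.Perm (Fin p) // f = g ∘ α}

theorem exists_perm_of_multiset_eq {f g : Fin p → ι}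
    (h : Finset.univ.val.map f = Finset.univ.val.map g) :
    ∃ α : Equiv.Perm (Fin p), f = g ∘ α := by
  have hc (i : ι) : Fintype.card {s // f s = i} = Fintype.card {s // g s = i} := by
    have := congrArg (Multiset.count i) h
    rw [Multiset.count_map, Multiset.count_map] at this
    simp only [Fintype.card_subtype, Finset.card_def, Finset.filter_val, eq_comm (b := i)]
    exact this
  refine ⟨Equiv.ofFiberEquiv (f := f) (g := g) fun i => Fintype.equivOfCardEq (hc i), ?_⟩
  funext s
  exact (Equiv.ofFiberEquiv_map _ s).symm

theorem numRearrangements_comp_left (f g : Fin p → ι) (β : Equiv.Perm (Fin p)) :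
    numRearrangements (f ∘ β) g = numRearrangements f g := by
  refine Fintype.card_congr ((Equiv.mulRight β⁻¹).subtypeEquiv fun α => ?_)
  constructor
  · intro h
    funext s
    simpa using congrFun h (β⁻¹ s)
  · intro h
    funext s
    simpa using congrFun h (β s)

theorem numRearrangements_comp_right (f g : Fin p → ι) (β : Equiv.Perm (Fin p)) :
    numRearrangements f (g ∘ β) = numRearrangements f g := by
  refine Fintype.card_congr ((Equiv.mulLeft β).subtypeEquiv fun α => ?_)
  rfl

theorem numRearrangements_eq_zero {f g : Fin p → ι}
    (h : Finset.univ.val.map f ≠ Finset.univ.val.map g) : numRearrangements f g = 0 := by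
  rw [numRearrangements, Fintype.card_eq_zero_iff]
  refine ⟨fun α => h ?_⟩
  rw [α.2, multiset_comp_perm]

variable [Fintype ι]

theorem sum_numRearrangements_left (g : Fin p → ι) :
    ∑ f : Fin p → ι, numRearrangements f g = p.factorial := by
  simp only [numRearrangements, Fintype.card_subtype, Finset.card_filter]
  rw [Finset.sum_comm]
  simp [Fintype.card_perm]

/-- Group the words by their multiset of values. Within the class of `g` the summand equals
`numRearrangements f g`, which vanishes outside it, so each class contributes `p!`; the classes are
counted by multichoose. -/
theorem sum_numRearrangements_self :
    ∑ f : Fin p → ι, numRearrangements f f = ∏ j ∈ Finset.range p, (Fintype.card ι + j) := by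
  classical
  let T : (Fin p → ι) → Sym ι p := fun f => ⟨Finset.univ.val.map f, by simp⟩
  have hT (s : Sym ι p) : ∑ f with T f = s, numRearrangements f f = p.factorial := by
    obtain ⟨g, rfl⟩ : ∃ g, T g = s := by
      obtain ⟨m, hm⟩ := s
      induction m using Quotient.inductionOn with
      | _ l =>
        have hl : l.length = p := by simpa using hm
        subst hl
        refine ⟨l.get, Subtype.ext ?_⟩
        simp [T]
    rw [← sum_numRearrangements_left g, Finset.sum_filter]
    refine Finset.sum_congr rfl fun f _ => ?_
    split_ifs with h
    · obtain ⟨α, rfl⟩ := exists_perm_of_multiset_eq (congrArg Subtype.val h)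
      rw [numRearrangements_comp_right]
    · exact (numRearrangements_eq_zero fun h' => h (Subtype.ext h')).symm
  rw [← Finset.sum_fiberwise Finset.univ T, Finset.sum_congr rfl fun s _ => hT s,
    Finset.sum_const, Finset.card_univ, Sym.card_sym_eq_multichoose, smul_eq_mul,
    ← Nat.ascFactorial_eq_prod_range, Nat.ascFactorial_eq_factorial_mul_choose',
    Nat.multichoose_eq, mul_comm]

end Rearrangements

/-! ### Traces of powers as sums over closed paths -/

section Trace

variable {m R : Type*} [Fintype m] [DecidableEq m] [CommSemiring R]

theorem pow_succ_apply_eq_sum_paths (A : Matrix m m R) (q : ℕ) (a b : m) :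
    (A ^ (q + 1)) a b = ∑ f : Fin q → m, ∏ s : Fin (q + 1),
      A (Fin.cons (α := fun _ => m) a f s) (Fin.snoc (α := fun _ => m) f b s) := by
  induction q generalizing a with
  | zero => simp [Fin.snoc]
  | succ q ih =>
    rw [pow_succ', Matrix.mul_apply, ← (Fin.consEquiv fun _ => m).sum_comp,
      Fintype.sum_prod_type]
    refine Finset.sum_congr rfl fun c _ => ?_
    rw [ih, Finset.mul_sum]
    refine Finset.sum_congr rfl fun f _ => ?_
    change _ = ∏ s, A (Fin.cons (α := fun _ => m) a (Fin.cons (α := fun _ => m) c f) s)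
      (Fin.snoc (α := fun _ => m) (Fin.cons (α := fun _ => m) c f) b s)
    rw [← Fin.cons_snoc_eq_snoc_cons, Fin.prod_univ_succ (n := q + 1)]
    simp only [Fin.cons_zero, Fin.cons_succ]

theorem trace_pow_eq_sum (A : Matrix m m R) {p : ℕ} (hp : 1 ≤ p) :
    (A ^ p).trace = ∑ f : Fin p → m, ∏ s, A (f s) (f (finRotate p s)) := by
  obtain ⟨q, rfl⟩ := Nat.exists_eq_add_of_le' hp
  rw [Matrix.trace, ← (Fin.consEquiv fun _ => m).sum_comp, Fintype.sum_prod_type]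
  refine Finset.sum_congr rfl fun a _ => ?_
  rw [Matrix.diag_apply, pow_succ_apply_eq_sum_paths]
  simp only [Fin.snoc_eq_cons_rotate, Fin.consEquiv_apply]

end Trace

/-! ### Recovering coefficients from values of a form -/

section Coefficients

variable {ι : Type*} [Fintype ι] [DecidableEq ι] {p : ℕ}

omit [Fintype ι] in
theorem prod_X_eq_monomial (f : Fin p → ι) :
    ∏ s, (MvPolynomial.X (f s) : MvPolynomial ι ℂ) =
      MvPolynomial.monomial (Multiset.toFinsupp (Finset.univ.val.map f)) 1 := by
  have h : Finset.univ.val.map f = ∑ s, ({f s} : Multiset ι) := by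
    rw [Finset.sum, ← Multiset.sum_map_singleton (Finset.univ.val.map f), Multiset.map_map]
    rfl
  rw [h, map_sum, MvPolynomial.monomial_sum_one]
  simp only [Multiset.toFinsupp_singleton]
  rfl

/-- Real points suffice. There conjugation is lost and only the combined exponent `M f + M g` is
visible, but `h0` leaves just the terms with `M f = M g`, for which the sum determines both. -/
theorem eq_zero_of_forall_sum_eq_zero {A : (Fin p → ι) → (Fin p → ι) → ℂ}
    (hl : ∀ f g (β : Equiv.Perm (Fin p)), A (f ∘ β) g = A f g)
    (hr : ∀ f g (β : Equiv.Perm (Fin p)), A f (g ∘ β) = A f g)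
    (h0 : ∀ f g, Finset.univ.val.map f ≠ Finset.univ.val.map g → A f g = 0)
    (hsum : ∀ x : ι → ℂ, ∑ f, ∑ g, A f g * ∏ s, (star (x (f s)) * x (g s)) = 0)
    (f₀ g₀ : Fin p → ι) : A f₀ g₀ = 0 := by
  classical
  let M : (Fin p → ι) → ι →₀ ℕ := fun f => Multiset.toFinsupp (Finset.univ.val.map f)
  let Q : MvPolynomial ι ℂ := ∑ f, ∑ g, MvPolynomial.monomial (M f + M g) (A f g)
  have hQ : Q = 0 := by
    refine MvPolynomial.funext_set (fun _ => Set.range ((↑) : ℝ → ℂ))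
      (fun _ => Set.infinite_range_of_injective Complex.ofReal_injective) fun x hx => ?_
    rw [map_zero, ← hsum x]
    simp only [Q, map_sum]
    refine Finset.sum_congr rfl fun f _ => Finset.sum_congr rfl fun g _ => ?_
    have hm : MvPolynomial.monomial (M f + M g) (A f g) =
        MvPolynomial.C (A f g) * ((∏ s, MvPolynomial.X (f s)) * ∏ s, MvPolynomial.X (g s)) := by
      rw [prod_X_eq_monomial, prod_X_eq_monomial, MvPolynomial.monomial_mul,
        MvPolynomial.C_mul_monomial]
      simp [M]
    have hx' (i : ι) : star (x i) = x i := by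
      obtain ⟨r, hr⟩ := hx i (Set.mem_univ i)
      rw [← hr]
      exact Complex.conj_ofReal r
    rw [hm]
    simp [Finset.prod_mul_distrib, hx']
  by_cases hfg : Finset.univ.val.map f₀ = Finset.univ.val.map g₀
  swap
  · exact h0 _ _ hfg
  obtain ⟨β, rfl⟩ := exists_perm_of_multiset_eq hfg
  rw [hl]
  have hM {f g : Fin p → ι} : M f = M g ↔ Finset.univ.val.map f = Finset.univ.val.map g :=
    Multiset.toFinsupp.injective.eq_iff
  -- By symmetry every contributing term equals `A g₀ g₀`, so this coefficient of `Q` is a positive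
  -- multiple of it.
  have hcoeff (f g : Fin p → ι) : (MvPolynomial.monomial (M f + M g) (A f g)).coeff (M g₀ + M g₀) =
      if M f = M g₀ ∧ M g = M g₀ then A g₀ g₀ else 0 := by
    rw [MvPolynomial.coeff_monomial]
    by_cases h : M f = M g
    · split_ifs with h1 h2 h2
      · obtain ⟨α, rfl⟩ := exists_perm_of_multiset_eq (hM.1 h2.1)
        obtain ⟨α', rfl⟩ := exists_perm_of_multiset_eq (hM.1 h2.2)
        rw [hl, hr]
      · refine absurd ?_ h2
        rw [h, and_self]
        rw [h] at h1
        ext i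
        have := DFunLike.congr_fun h1 i
        simp only [Finsupp.add_apply] at this
        omega
      · exact absurd (by rw [h2.1, h2.2]) h1
      · rfl
    · rw [h0 f g (fun h' => h (hM.2 h')), ite_self, if_neg]
      exact fun h' => h (h'.1.trans h'.2.symm)
  have hc := congrArg (MvPolynomial.coeff (M g₀ + M g₀)) hQ
  simp only [Q, MvPolynomial.coeff_sum, hcoeff, MvPolynomial.coeff_zero] at hc
  rw [← Fintype.sum_prod_type' (f := fun f g => if M f = M g₀ ∧ M g = M g₀ then A g₀ g₀ else 0),
    ← Finset.sum_filter, Finset.sum_const, nsmul_eq_mul, mul_eq_zero] at hc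
  refine hc.resolve_left ?_
  rw [Nat.cast_eq_zero, Finset.card_eq_zero]
  exact Finset.Nonempty.ne_empty ⟨(g₀, g₀), by simp⟩

theorem sum_numRearrangements_mul (x : ι → ℂ) :
    ∑ f : Fin p → ι, ∑ g : Fin p → ι,
      (numRearrangements f g : ℂ) * ∏ s, (star (x (f s)) * x (g s)) =
      p.factorial * (∑ i, x i * star (x i)) ^ p := by
  classical
  have hn (f g : Fin p → ι) : (numRearrangements f g : ℂ) =
      ∑ α : Equiv.Perm (Fin p), if f = g ∘ α then 1 else 0 := by
    simp [numRearrangements, Fintype.card_subtype]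
  rw [Finset.sum_comm, Fintype.sum_pow, Finset.mul_sum]
  refine Finset.sum_congr rfl fun g _ => ?_
  simp only [hn, Finset.sum_mul, ite_mul, one_mul, zero_mul]
  rw [Finset.sum_comm]
  simp only [Finset.sum_ite_eq', Finset.mem_univ, if_true, Function.comp_apply]
  have hα (α : Equiv.Perm (Fin p)) : ∏ s, (star (x (g (α s))) * x (g s)) =
      ∏ s, (x (g s) * star (x (g s))) := by
    rw [Finset.prod_mul_distrib, Finset.prod_mul_distrib, mul_comm,
      Equiv.prod_comp α fun s => star (x (g s))]
  simp only [hα, Finset.sum_const, Finset.card_univ, Fintype.card_perm, Fintype.card_fin,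
    nsmul_eq_mul]

end Coefficients

/-! ### Unitary action on vectors -/

section Unitary

variable {ι : Type*} [Fintype ι] [DecidableEq ι]

theorem sum_mulVec_mul_star (U : Matrix.unitaryGroup ι ℂ) (v : ι → ℂ) :
    ∑ i, (U.1 *ᵥ v) i * star ((U.1 *ᵥ v) i) = ∑ i, v i * star (v i) := by
  change (U.1 *ᵥ v) ⬝ᵥ star (U.1 *ᵥ v) = v ⬝ᵥ star v
  have hU : (U.1)ᴴ * U.1 = 1 := Matrix.mem_unitaryGroup_iff'.1 U.2
  rw [Matrix.star_mulVec, dotProduct_comm, ← Matrix.dotProduct_mulVec, Matrix.mulVec_mulVec, hU,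
    Matrix.one_mulVec, dotProduct_comm]

theorem norm_mulVec_apply_le_one (U : Matrix.unitaryGroup ι ℂ) {v : ι → ℂ}
    (hv : ∑ i, v i * star (v i) = 1) (i : ι) : ‖(U.1 *ᵥ v) i‖ ≤ 1 := by
  have h := sum_mulVec_mul_star U v
  have hs (z : ℂ) : z * star z = ((‖z‖ ^ 2 : ℝ) : ℂ) := by
    rw [Complex.star_def, Complex.mul_conj, Complex.normSq_eq_norm_sq]
  rw [hv] at h
  simp only [hs] at h
  have h' : ∑ i, ‖(U.1 *ᵥ v) i‖ ^ 2 = 1 := by exact_mod_cast h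
  have := Finset.single_le_sum (f := fun i => ‖(U.1 *ᵥ v) i‖ ^ 2)
    (fun i _ => sq_nonneg _) (Finset.mem_univ i)
  rw [h'] at this
  exact (sq_le_one_iff₀ (norm_nonneg _)).1 this

/-- Every nonzero vector is a positive multiple of the `i₀`-th column of a unitary matrix. -/
theorem exists_unitary_column (x : ι → ℂ) (hx : x ≠ 0) (i₀ : ι) :
    ∃ (V : Matrix.unitaryGroup ι ℂ) (r : ℝ), ((r : ℂ) ^ 2 = ∑ i, x i * star (x i)) ∧
      ∀ i, x i = r * V.1 i i₀ := by
  let y : EuclideanSpace ℂ ι := WithLp.toLp 2 x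
  have hy : y ≠ 0 := fun h => hx (congrArg WithLp.ofLp h)
  have hn : ‖y‖ ≠ 0 := norm_ne_zero_iff.2 hy
  have ho : Orthonormal ℂ (({i₀} : Set ι).domRestrict fun _ => ((‖y‖ : ℂ)⁻¹) • y) := by
    refine ⟨fun _ => ?_, fun i j hij => absurd (Subsingleton.elim i j) hij⟩
    simp [Set.domRestrict, norm_smul, hn]
  obtain ⟨b, hb⟩ := ho.exists_orthonormalBasis_extension_of_card_eq (by simp)
  refine ⟨⟨_, (EuclideanSpace.basisFun ι ℂ).toMatrix_orthonormalBasis_mem_unitary b⟩, ‖y‖, ?_,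
    fun i => ?_⟩
  · rw [← Complex.ofReal_pow, EuclideanSpace.norm_sq_eq]
    push_cast
    refine Finset.sum_congr rfl fun i _ => ?_
    rw [Complex.star_def, Complex.mul_conj, Complex.normSq_eq_norm_sq]
    simp [y]
  · have : (‖y‖ : ℂ) ≠ 0 := by exact_mod_cast hn
    simp [Module.Basis.toMatrix_apply, hb i₀ rfl, y, this]

end Unitary

/-! ### Moments of the random vector `U v` -/

section Moments

variable {ι : Type*} [Fintype ι] [DecidableEq ι] {p : ℕ}
  [MeasurableSpace (Matrix.unitaryGroup ι ℂ)] [BorelSpace (Matrix.unitaryGroup ι ℂ)]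
  (μ : Measure (Matrix.unitaryGroup ι ℂ)) {v : ι → ℂ}

/-- The mixed moments of the coordinates of the random vector `U v`. -/
noncomputable def moment (v : ι → ℂ) (f g : Fin p → ι) : ℂ :=
  ∫ U, ∏ s, ((U.1 *ᵥ v) (f s) * star ((U.1 *ᵥ v) (g s))) ∂μ

theorem integrable_prod_mulVec [IsProbabilityMeasure μ] (hv : ∑ i, v i * star (v i) = 1)
    (f g : Fin p → ι) :
    Integrable (fun U : Matrix.unitaryGroup ι ℂ =>
      ∏ s, ((U.1 *ᵥ v) (f s) * star ((U.1 *ᵥ v) (g s)))) μ := by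
  have hc (i : ι) : Continuous fun U : Matrix.unitaryGroup ι ℂ => (U.1 *ᵥ v) i :=
    (continuous_apply i).comp (continuous_subtype_val.matrix_mulVec continuous_const)
  refine Integrable.of_bound (C := 1) (Continuous.aestronglyMeasurable ?_) (.of_forall fun U => ?_)
  · exact continuous_finsetProd _ fun s _ => (hc _).mul (hc _).star
  · rw [norm_prod]
    refine Finset.prod_le_one (fun s _ => norm_nonneg _) fun s _ => ?_
    rw [norm_mul, norm_star]
    exact mul_le_one₀ (norm_mulVec_apply_le_one U hv _) (norm_nonneg _)
      (norm_mulVec_apply_le_one U hv _)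

omit [BorelSpace (Matrix.unitaryGroup ι ℂ)] in
theorem moment_comp_left (f g : Fin p → ι) (β : Equiv.Perm (Fin p)) :
    moment μ v (f ∘ β) g = moment μ v f g := by
  unfold moment
  congr 1
  funext U
  rw [Finset.prod_mul_distrib, Finset.prod_mul_distrib]
  congr 1
  exact Equiv.prod_comp β fun s => (U.1 *ᵥ v) (f s)

omit [BorelSpace (Matrix.unitaryGroup ι ℂ)] in
theorem moment_comp_right (f g : Fin p → ι) (β : Equiv.Perm (Fin p)) :
    moment μ v f (g ∘ β) = moment μ v f g := by
  unfold moment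
  congr 1
  funext U
  rw [Finset.prod_mul_distrib, Finset.prod_mul_distrib]
  congr 1
  exact Equiv.prod_comp β fun s => star ((U.1 *ᵥ v) (g s))

theorem integral_mulVec_left [μ.IsMulLeftInvariant] (F : (ι → ℂ) → ℂ)
    (V : Matrix.unitaryGroup ι ℂ) :
    ∫ U, F (V.1 *ᵥ (U.1 *ᵥ v)) ∂μ = ∫ U, F (U.1 *ᵥ v) ∂μ := by
  rw [← integral_mul_left_eq_self (fun U : Matrix.unitaryGroup ι ℂ => F (U.1 *ᵥ v)) V]
  simp [Matrix.mulVec_mulVec]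

/-- Left multiplication by a diagonal unitary with phase `ζ` at `i₀` scales the moment by `ζ` to the
multiplicity of `i₀` in `f`, times `star ζ` to its multiplicity in `g`. -/
theorem moment_eq_zero [μ.IsMulLeftInvariant] {f g : Fin p → ι}
    (h : Finset.univ.val.map f ≠ Finset.univ.val.map g) : moment μ v f g = 0 := by
  by_contra hne
  refine h (Multiset.ext.2 fun i₀ => ?_)
  -- Multiplicities lie in `0, …, p`, so order `p + 1` makes the powers of `ζ` distinguish them.
  have hζ := Complex.isPrimitiveRoot_exp (p + 1) (Nat.succ_ne_zero p)
  set ζ := Complex.exp (2 * Real.pi * Complex.I / (p + 1 : ℕ))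
  have hζn : ζ * star ζ = 1 := by
    rw [Complex.star_def, Complex.mul_conj, Complex.normSq_eq_norm_sq,
      hζ.norm'_eq_one (Nat.succ_ne_zero p)]
    simp
  let d : ι → ℂ := fun i => if i = i₀ then ζ else 1
  have hd (i : ι) : d i * star (d i) = 1 := by
    by_cases hi : i = i₀ <;> simp only [d, hi, if_true, if_false, star_one, mul_one, hζn]
  have hmem : Matrix.diagonal d ∈ Matrix.unitaryGroup ι ℂ := by
    rw [Matrix.mem_unitaryGroup_iff, Matrix.star_eq_conjTranspose, Matrix.diagonal_conjTranspose,
      Matrix.diagonal_mul_diagonal, ← Matrix.diagonal_one]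
    congr 1
    funext i
    exact hd i
  have hprod (f : Fin p → ι) :
      ∏ s, d (f s) = ζ ^ Multiset.count i₀ (Finset.univ.val.map f) := by
    simp only [d]
    rw [Finset.prod_ite, Finset.prod_const, Finset.prod_const_one, mul_one, Multiset.count_map]
    simp only [Finset.card_def, Finset.filter_val, eq_comm (a := i₀)]
  have hinv : (∏ s, d (f s)) * (∏ s, star (d (g s))) * moment μ v f g = moment μ v f g := by
    refine Eq.trans ?_ (integral_mulVec_left (v := v) μ
      (fun w => ∏ s, (w (f s) * star (w (g s)))) ⟨_, hmem⟩)
    rw [moment, ← integral_const_mul]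
    congr 1
    funext U
    simp only [Matrix.mulVec_diagonal, star_mul', Finset.prod_mul_distrib]
    ring
  have hg : ∏ s, star (d (g s)) = star ζ ^ Multiset.count i₀ (Finset.univ.val.map g) := by
    rw [← star_pow, ← hprod g, star_prod]
  rw [hprod f, hg] at hinv
  have h1 := mul_right_cancel₀ hne (hinv.trans (one_mul _).symm)
  have hle (f : Fin p → ι) : Multiset.count i₀ (Finset.univ.val.map f) < p + 1 :=
    Nat.lt_succ_of_le ((Multiset.count_le_card _ _).trans (by simp))
  refine hζ.pow_inj (hle f) (hle g) ?_
  rw [← mul_one (ζ ^ Multiset.count i₀ (Finset.univ.val.map f)), ← one_pow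
    (Multiset.count i₀ (Finset.univ.val.map g)), ← hζn, mul_comm ζ, mul_pow, ← mul_assoc, h1,
    one_mul]

theorem sum_moment_mul [IsProbabilityMeasure μ] (hv : ∑ i, v i * star (v i) = 1) (x : ι → ℂ) :
    ∑ f : Fin p → ι, ∑ g : Fin p → ι, moment μ v f g * ∏ s, (star (x (f s)) * x (g s)) =
      ∫ U, (∑ i, (U.1 *ᵥ v) i * star (x i)) ^ p * star (∑ i, (U.1 *ᵥ v) i * star (x i)) ^ p ∂μ := by
  have hi (f g : Fin p → ι) := (integrable_prod_mulVec μ hv f g).mul_const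
    (∏ s, (star (x (f s)) * x (g s)))
  simp only [moment, ← integral_mul_const]
  simp only [← integral_finsetSum _ fun g _ => hi _ g]
  rw [← integral_finsetSum _ fun f _ => integrable_finsetSum _ fun g _ => hi f g]
  congr 1
  funext U
  rw [star_sum, Fintype.sum_pow, Fintype.sum_pow, Finset.sum_mul_sum]
  refine Finset.sum_congr rfl fun f _ => Finset.sum_congr rfl fun g _ => ?_
  simp only [star_mul', star_star, Finset.prod_mul_distrib]
  ring

/-- Write `x` as `r` times the `i₀`-th column of a unitary `V`: pairing `U v` with `x` gives `r`
times the `i₀`-th coordinate of `V⁻¹ U v`, and invariance removes `V⁻¹`. -/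
theorem exists_sum_moment_mul [IsProbabilityMeasure μ] [μ.IsMulLeftInvariant] [Nonempty ι]
    (hp : 1 ≤ p) (hv : ∑ i, v i * star (v i) = 1) :
    ∃ C : ℂ, ∀ x : ι → ℂ,
      ∑ f : Fin p → ι, ∑ g : Fin p → ι, moment μ v f g * ∏ s, (star (x (f s)) * x (g s)) =
        C * (∑ i, x i * star (x i)) ^ p := by
  obtain ⟨i₀⟩ := ‹Nonempty ι›
  refine ⟨∫ U, (U.1 *ᵥ v) i₀ ^ p * star ((U.1 *ᵥ v) i₀) ^ p ∂μ, fun x => ?_⟩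
  rw [sum_moment_mul μ hv]
  by_cases hx : x = 0
  · simp [hx, zero_pow (Nat.one_le_iff_ne_zero.1 hp)]
  obtain ⟨V, r, hr, hV⟩ := exists_unitary_column x hx i₀
  have hsum (w : ι → ℂ) : ∑ i, w i * star (x i) = r * ((V⁻¹).1 *ᵥ w) i₀ := by
    rw [Matrix.mulVec, dotProduct, Finset.mul_sum]
    refine Finset.sum_congr rfl fun i _ => ?_
    have : (V⁻¹).1 i₀ i = star (V.1 i i₀) := rfl
    rw [this, hV i, star_mul', Complex.star_def, Complex.conj_ofReal]
    ring
  rw [← hr]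
  simp only [hsum]
  rw [← integral_mulVec_left μ (fun w => w i₀ ^ p * star (w i₀) ^ p) V⁻¹, mul_comm,
    ← integral_const_mul]
  congr 1
  funext U
  simp only [star_mul', Complex.star_def, Complex.conj_ofReal]
  ring

/-- The mixed moments of a uniformly distributed random unit vector. -/
theorem moment_eq [IsProbabilityMeasure μ] [μ.IsMulLeftInvariant] [Nonempty ι]
    (hp : 1 ≤ p) (hv : ∑ i, v i * star (v i) = 1) (f g : Fin p → ι) :
    moment μ v f g =
      (∏ j ∈ Finset.range p, ((Fintype.card ι : ℂ) + j))⁻¹ * numRearrangements f g := by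
  obtain ⟨C, hC⟩ := exists_sum_moment_mul (p := p) μ hp hv
  have hfact : (p.factorial : ℂ) ≠ 0 := by exact_mod_cast p.factorial_ne_zero
  have key (f g : Fin p → ι) : moment μ v f g - C / p.factorial * numRearrangements f g = 0 := by
    refine eq_zero_of_forall_sum_eq_zero
      (A := fun f g => moment μ v f g - C / p.factorial * numRearrangements f g)
      (fun f g β => ?_) (fun f g β => ?_) (fun f g h => ?_) (fun x => ?_) f g
    · simp only [moment_comp_left, numRearrangements_comp_left]
    · simp only [moment_comp_right, numRearrangements_comp_right]
    · simp only [moment_eq_zero μ h, numRearrangements_eq_zero h, Nat.cast_zero, mul_zero, sub_zero]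
    · simp only [sub_mul, Finset.sum_sub_distrib, hC, mul_assoc, ← Finset.mul_sum,
        sum_numRearrangements_mul]
      field_simp
      ring
  -- The diagonal moments sum to `E ‖U v‖ ^ (2p)`, which determines `C`.
  have hone : ∑ f : Fin p → ι, moment μ v f f = 1 := by
    simp only [moment]
    rw [← integral_finsetSum _ fun f _ => integrable_prod_mulVec μ hv f f]
    have hpt (U : Matrix.unitaryGroup ι ℂ) :
        ∑ f : Fin p → ι, ∏ s, ((U.1 *ᵥ v) (f s) * star ((U.1 *ᵥ v) (f s))) = 1 := by
      rw [← Fintype.sum_pow fun i => (U.1 *ᵥ v) i * star ((U.1 *ᵥ v) i), sum_mulVec_mul_star, hv,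
        one_pow]
    simp only [hpt, integral_const, probReal_univ, one_smul]
  have hc : C / p.factorial * ∏ j ∈ Finset.range p, ((Fintype.card ι : ℂ) + j) = 1 := by
    rw [← hone, Finset.sum_congr rfl fun f _ => sub_eq_zero.1 (key f f), ← Finset.mul_sum,
      ← Nat.cast_sum, sum_numRearrangements_self]
    push_cast
    rfl
  rw [sub_eq_zero.1 (key f g), eq_inv_of_mul_eq_one_left hc]

end Moments

/-! ### Rank-one projectors and the channel output -/

theorem IsRankOneProjector.exists_eq_vecMulVec {m : Type*} [Fintype m] [DecidableEq m]
    {X : Matrix m m ℂ} (hX : IsRankOneProjector X) :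
    ∃ u : m → ℂ, X = Matrix.vecMulVec u (star u) ∧ ∑ i, u i * star (u i) = 1 := by
  obtain ⟨hP, hr⟩ := hX
  have hidem : X * X = X := hP.isIdempotentElem
  have hself : Xᴴ = X := hP.isSelfAdjoint
  have hX0 : X ≠ 0 := by
    rintro rfl
    simp at hr
  obtain ⟨u, c, huc⟩ : ∃ u c : m → ℂ, X = Matrix.vecMulVec u c := by
    rw [Matrix.rank, finrank_eq_one_iff'] at hr
    obtain ⟨u, -, hu⟩ := hr
    choose c hc using fun j => hu ⟨X *ᵥ Pi.single j 1, ⟨Pi.single j 1, rfl⟩⟩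
    refine ⟨u.1, c, ?_⟩
    ext i j
    have := congrFun (congrArg Subtype.val (hc j)) i
    simp only [Matrix.mulVec_single_one] at this
    rw [Matrix.vecMulVec_apply, mul_comm]
    exact this.symm
  -- Expanding `X = X Xᴴ` gives a nonnegative scalar, whose square root can be absorbed into `u`.
  have hXs : X = (c ⬝ᵥ star c) • Matrix.vecMulVec u (star u) := by
    conv_lhs => rw [← hidem]
    nth_rw 2 [← hself]
    rw [huc, Matrix.conjTranspose_vecMulVec, Matrix.vecMulVec_mul_vecMulVec,
      Matrix.vecMulVec_smul]
  let t : ℝ := ∑ i, ‖c i‖ ^ 2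
  have ht0 : 0 ≤ t := Finset.sum_nonneg fun i _ => sq_nonneg _
  have ht : c ⬝ᵥ star c = (t : ℂ) := by
    simp only [t, dotProduct, Pi.star_apply, Complex.star_def, Complex.mul_conj,
      Complex.normSq_eq_norm_sq, Complex.ofReal_sum]
  have hXu : X = Matrix.vecMulVec ((Real.sqrt t : ℂ) • u) (star ((Real.sqrt t : ℂ) • u)) := by
    have hs : ((Real.sqrt t : ℝ) : ℂ) * Real.sqrt t = t := by
      exact_mod_cast Real.mul_self_sqrt ht0
    rw [hXs, ht, star_smul, Complex.star_def, Complex.conj_ofReal, Matrix.smul_vecMulVec,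
      Matrix.vecMulVec_smul, smul_smul, hs]
  refine ⟨_, hXu, ?_⟩
  generalize (Real.sqrt t : ℂ) • u = w at hXu
  have hw := hidem
  rw [hXu, Matrix.vecMulVec_mul_vecMulVec, Matrix.vecMulVec_smul, ← hXu] at hw
  have h1 : (star w ⬝ᵥ w - 1) • X = 0 := by rw [sub_smul, one_smul, hw, sub_self]
  have h2 := (smul_eq_zero.1 h1).resolve_right hX0
  rw [dotProduct_comm] at h2
  exact sub_eq_zero.1 h2

theorem channel_apply {n k : ℕ} (U : Matrix.unitaryGroup (Fin n × Fin k) ℂ)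
    (x : Fin n → ℂ) (y : Fin k → ℂ) (i j : Fin n) :
    channel U (Matrix.vecMulVec y (star y)) (Matrix.vecMulVec x (star x)) i j =
      ∑ a, (U.1 *ᵥ fun q => x q.1 * y q.2) (i, a) *
        star ((U.1 *ᵥ fun q => x q.1 * y q.2) (j, a)) := by
  have h : Matrix.vecMulVec x (star x) ⊗ₖ Matrix.vecMulVec y (star y) =
      Matrix.vecMulVec (fun q : Fin n × Fin k => x q.1 * y q.2)
        (star fun q : Fin n × Fin k => x q.1 * y q.2) := by
    ext ⟨i, a⟩ ⟨j, b⟩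
    simp [Matrix.vecMulVec_apply]
    ring
  simp only [channel, partialTrace, Matrix.of_apply, h, Matrix.mul_vecMulVec,
    Matrix.vecMulVec_mul, ← Matrix.star_mulVec, Matrix.vecMulVec_apply, Pi.star_apply]

theorem trace_channel_pow {n k p : ℕ} (hp : 1 ≤ p) (U : Matrix.unitaryGroup (Fin n × Fin k) ℂ)
    (x : Fin n → ℂ) (y : Fin k → ℂ) :
    (channel U (Matrix.vecMulVec y (star y)) (Matrix.vecMulVec x (star x)) ^ p).trace =
      ∑ i : Fin p → Fin n, ∑ a : Fin p → Fin k,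
        ∏ s, ((U.1 *ᵥ fun q => x q.1 * y q.2) (i s, a s) *
          star ((U.1 *ᵥ fun q => x q.1 * y q.2) (i (finRotate p s), a s))) := by
  rw [trace_pow_eq_sum _ hp]
  refine Finset.sum_congr rfl fun i _ => ?_
  simp only [channel_apply]
  exact Fintype.prod_sum _

/-- Since `γ⁻¹` is `finRotate p`, the condition on `α` splits coordinatewise into `i = i ∘ (γ⁻¹ α)`
and `a = a ∘ α`; then `card_comp_eq_self` counts each. -/
theorem sum_numRearrangements_rotate (n k p : ℕ) :
    ∑ i : Fin p → Fin n, ∑ a : Fin p → Fin k,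
      (numRearrangements (fun s => (i s, a s)) (fun s => (i (finRotate p s), a s)) : ℂ) =
    ∑ α : Equiv.Perm (Fin p),
      (k : ℂ) ^ numCycles α * (n : ℂ) ^ numCycles ((fullCycle p)⁻¹ * α) := by
  have hc (q : ℕ) (σ : Equiv.Perm (Fin p)) : (q : ℂ) ^ numCycles σ =
      ∑ a : Fin p → Fin q, if a ∘ σ = a then 1 else 0 := by
    have := card_comp_eq_self (κ := Fin q) σ
    rw [Fintype.card_fin] at this
    rw [← Nat.cast_pow, ← this, Fintype.card_subtype]
    simp
  have hn (i : Fin p → Fin n) (a : Fin p → Fin k) :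
      (numRearrangements (fun s => (i s, a s)) (fun s => (i (finRotate p s), a s)) : ℂ) =
      ∑ α : Equiv.Perm (Fin p), (if i ∘ ((fullCycle p)⁻¹ * α) = i then 1 else 0) *
        (if a ∘ α = a then 1 else 0) := by
    rw [numRearrangements, Fintype.card_subtype, Finset.card_filter, Nat.cast_sum]
    refine Finset.sum_congr rfl fun α _ => ?_
    rw [ite_zero_mul_ite_zero, one_mul, Nat.cast_ite, Nat.cast_one, Nat.cast_zero]
    refine if_congr ?_ rfl rfl
    simp only [fullCycle, inv_inv, funext_iff, Function.comp_apply, Prod.mk.injEq,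
      Equiv.Perm.mul_apply, forall_and]
    simp only [eq_comm]
  simp only [hn, hc, Finset.sum_mul_sum]
  rw [Finset.sum_congr rfl fun i _ => Finset.sum_comm, Finset.sum_comm]
  refine Finset.sum_congr rfl fun α _ => ?_
  rw [Finset.sum_comm]
  simp only [mul_comm]

end RandomChannel

theorem mainTheorem7 {n k p : ℕ} (hp : 1 ≤ p)
    [MeasurableSpace (Matrix.unitaryGroup (Fin n × Fin k) ℂ)]
    [BorelSpace (Matrix.unitaryGroup (Fin n × Fin k) ℂ)]
    {Ω : Type*} [MeasurableSpace Ω] (P : Measure Ω) [IsProbabilityMeasure P]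
    (U : Ω → Matrix.unitaryGroup (Fin n × Fin k) ℂ) (hU : Measurable U)
    (hHaar : (P.map U).IsHaarMeasure)
    (X : Matrix (Fin n) (Fin n) ℂ) (hX : RandomChannel.IsRankOneProjector X)
    (Y : Matrix (Fin k) (Fin k) ℂ) (hY : RandomChannel.IsRankOneProjector Y) :
    Integrable (fun ω => (RandomChannel.channel (U ω) Y X ^ p).trace) P ∧
    ∫ ω, (RandomChannel.channel (U ω) Y X ^ p).trace ∂P =
      (∏ j ∈ Finset.range p, ((n : ℂ) * (k : ℂ) + (j : ℂ)))⁻¹ *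
        ∑ α : Equiv.Perm (Fin p),
          (k : ℂ) ^ RandomChannel.numCycles α *
            (n : ℂ) ^ RandomChannel.numCycles ((RandomChannel.fullCycle p)⁻¹ * α) := by
  obtain ⟨x, rfl, hx⟩ := hX.exists_eq_vecMulVec
  obtain ⟨y, rfl, hy⟩ := hY.exists_eq_vecMulVec
  have hμ : IsProbabilityMeasure (P.map U) := Measure.isProbabilityMeasure_map hU.aemeasurable
  have hv : ∑ q : Fin n × Fin k, x q.1 * y q.2 * star (x q.1 * y q.2) = 1 := by
    rw [Fintype.sum_prod_type, ← one_mul (1 : ℂ)]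
    nth_rw 1 [← hx]
    rw [← hy, Finset.sum_mul_sum]
    refine Finset.sum_congr rfl fun i _ => Finset.sum_congr rfl fun a _ => ?_
    rw [star_mul']
    ring
  have hne : Nonempty (Fin n × Fin k) := by
    by_contra h
    rw [not_nonempty_iff] at h
    simp at hv
  have hi (i : Fin p → Fin n) (a : Fin p → Fin k) :=
    RandomChannel.integrable_prod_mulVec (P.map U) hv (fun s => (i s, a s))
      (fun s => (i (finRotate p s), a s))
  have hint := integrable_finsetSum Finset.univ fun i _ =>
    integrable_finsetSum Finset.univ fun a _ => hi i a
  simp only [RandomChannel.trace_channel_pow hp]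
  refine ⟨hint.comp_measurable hU, ?_⟩
  refine (integral_map hU.aemeasurable hint.aestronglyMeasurable).symm.trans ?_
  rw [integral_finsetSum _ fun i _ => integrable_finsetSum _ fun a _ => hi i a]
  simp only [integral_finsetSum _ fun a _ => hi _ a]
  have hm (i : Fin p → Fin n) (a : Fin p → Fin k) :=
    RandomChannel.moment_eq (P.map U) hp hv (fun s => (i s, a s))
      (fun s => (i (finRotate p s), a s))
  simp only [RandomChannel.moment] at hm
  simp only [hm, ← Finset.mul_sum, RandomChannel.sum_numRearrangements_rotate, Fintype.card_prod,
    Fintype.card_fin, Nat.cast_mul]
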